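/- **Definitions.** For a prime $p$, a $\delta_p$-structure on a commutative ring $A$ is a map $\delta_p\colon A\to A$ with $\delta_p(0)=\delta_p(1)=0$, $$\delta_p(x+y)=\delta_p(x)+\delta_p(y)+\tfrac1p\bigl(x^p+y^p-(x+y)^p\bigr),\qquad \delta_p(xy)=x^p\delta_p(y)+y^p\delta_p(x)+p\,\delta_p(x)\delta_p(y)$$ (where $\tfrac1p(x^p+y^p-(x+y)^p)$ is read as a polynomial with integer coefficients). A $\widehat\delta$-ring is a commutative ring $R$, here always with bounded $p$-power torsion for every prime $p$, together with a $\delta_p$-structure on the $p$-completion $R^\wedge_p$ for every prime $p$; a map of $\widehat\delta$-rings $R\to S$ is a ring homomorphism $f$ such that the induced map $f^\wedge_p\colon R^\wedge_p\to S^\wedge_p$ commutes with $\delta_p$ for every prime $p$. For an abelian group $M$, the group ring $\mathbb Z[M]$ has for each prime $p$ the $\delta_p$-structure $\delta_p(x)=(\varphi_p(x)-x^p)/p$, where $\varphi_p\bigl(\sum_m a_m[m]\bigr)=\sum_m a_m[pm]$; it extends to a $\delta_p$-structure on $\mathbb Z[M]^\wedge_p$ given modulo $p^n$ by $\delta_p$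 of any lift modulo $p^{n+1}$, and this makes $\mathbb Z[M]$ a $\widehat\delta$-ring. The rank-$1$ $\widehat\delta$-units of a $\widehat\delta$-ring $R$ are the maps of $\widehat\delta$-rings $\mathbb Z[t^{\pm1}]=\mathbb Z[\mathbb Z]\to R$. **Theorem.** Let $M$ and $N$ be finitely generated abelian groups. 1. The natural map $$\operatorname{Hom}_{\mathrm{Ab}}(N,M)\longrightarrow \operatorname{Hom}_{\widehat\delta\text{-}\mathrm{Ring}}(\mathbb Z[N],\mathbb Z[M]),\qquad f\longmapsto\bigl([n]\mapsto[f(n)]\bigr)$$ is a bijection. 2. In particular, sending $m\in M$ to the map $t\mapsto[m]$ is a bijection from $M$ to the set of rank-$1$ $\widehat\delta$-units of $\mathbb Z[M]$. A unit $u\in\mathbb Z[M]^\times$ is the image of $t$ under some map of $\widehat\delta$-rings $\mathbb Z[t^{\pm1}]\to\mathbb Z[M]$ if and only if, for every prime $p$, $\delta_p(u)=0$ in $\mathbb Z[M]^\wedge_p$. These units form a subgroup $\mathbb G_m^{\widehat\delta}(\mathbb Z[M])\subseteq\mathbb Z[M]^\times$, and $m\mapsto[m]$ is an isomorphism of groups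 $M\cong\mathbb G_m^{\widehat\delta}(\mathbb Z[M])$. -/

import Mathlib

open scoped BigOperators

/-! ### `δ_p`-rings -/

/-- A `δ_p`-structure on a commutative ring `A` (meant for `p` prime).  For `p` prime and
`0 < i < p` the natural number division `p.choose i / p` is exact, so the sum below is
`((x + y) ^ p - x ^ p - y ^ p) / p`, read as an integral polynomial in `x` and `y`. -/
class DeltaRing (p : ℕ) (A : Type*) [CommRing A] where
  delta : A → A
  delta_zero : delta 0 = 0
  delta_one : delta 1 = 0
  delta_add : ∀ x y : A, delta (x + y) = delta x + delta y -
    ∑ i ∈ Finset.Ioo 0 p, ((p.choose i / p : ℕ) : A) * x ^ i * y ^ (p - i)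
  delta_mul : ∀ x y : A, delta (x * y) =
    x ^ p * delta y + y ^ p * delta x + (p : A) * delta x * delta y

theorem add_pow_eq_add_prime_mul {A : Type*} [CommRing A] {p : ℕ} (hp : p.Prime) (x y : A) :
    (x + y) ^ p = x ^ p + y ^ p +
      p * ∑ i ∈ Finset.Ioo 0 p, ((p.choose i / p : ℕ) : A) * x ^ i * y ^ (p - i) := by
  rw [add_pow, Finset.sum_range_succ, Finset.range_eq_Ico,
    Finset.sum_eq_sum_Ico_succ_bot hp.pos]
  have h : Finset.Ico (0 + 1) p = Finset.Ioo 0 p := by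
    ext i; simp [Finset.mem_Ico, Finset.mem_Ioo, Nat.succ_le_iff]
  rw [h, Finset.mul_sum]
  have h2 : ∑ i ∈ Finset.Ioo 0 p, x ^ i * y ^ (p - i) * (p.choose i : A) =
      ∑ i ∈ Finset.Ioo 0 p,
        (p : A) * (((p.choose i / p : ℕ) : A) * x ^ i * y ^ (p - i)) := by
    refine Finset.sum_congr rfl fun i hi => ?_
    rw [Finset.mem_Ioo] at hi
    have h3 : p.choose i = p * (p.choose i / p) :=
      (Nat.mul_div_cancel' (hp.dvd_choose_self hi.1.ne' hi.2)).symm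
    have h4 : (p.choose i : A) = (p : A) * ((p.choose i / p : ℕ) : A) := by
      exact_mod_cast congrArg (Nat.cast (R := A)) h3
    rw [h4]; ring
  rw [h2]
  simp
  ring

/-- The `δ_p`-structure `δ_p(x) = (φ(x) - x ^ p) / p` attached to a lift `φ` of the Frobenius on
a `p`-torsion-free ring. -/
@[reducible]
noncomputable def DeltaRing.ofFrobeniusLift {A : Type*} [CommRing A] {p : ℕ} (hp : p.Prime)
    (htf : ∀ x : A, (p : A) * x = 0 → x = 0) (φ : A →+* A)
    (hφ : ∀ x : A, ∃ d : A, φ x = x ^ p + p * d) : DeltaRing p A :=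
  have key : ∀ {a b : A}, (p : A) * a = p * b → a = b := fun {a b} h =>
    sub_eq_zero.1 (htf _ (by rw [mul_sub, h, sub_self]))
  have spec : ∀ x : A, (p : A) * (hφ x).choose = φ x - x ^ p := fun x => by
    have h := (hφ x).choose_spec
    generalize (hφ x).choose = d at h
    rw [h, add_sub_cancel_left]
  { delta := fun x => (hφ x).choose
    delta_zero := key (by rw [spec]; simp [hp.ne_zero])
    delta_one := key (by rw [spec]; simp)
    delta_add := fun x y => key (by
      have h := add_pow_eq_add_prime_mul hp x y
      rw [mul_sub, mul_add, spec, spec, spec, map_add]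
      linear_combination -h)
    delta_mul := fun x y => key (by
      have hx := spec x
      have hy := spec y
      rw [spec, map_mul]
      generalize (hφ x).choose = a at *
      generalize (hφ y).choose = b at *
      rw [eq_sub_iff_add_eq] at hx hy
      rw [← hx, ← hy]; ring) }

theorem DeltaRing.ofFrobeniusLift_spec {A : Type*} [CommRing A] {p : ℕ} (hp : p.Prime)
    (htf : ∀ x : A, (p : A) * x = 0 → x = 0) (φ : A →+* A)
    (hφ : ∀ x : A, ∃ d : A, φ x = x ^ p + p * d) (x : A) :
    φ x = x ^ p + p * (DeltaRing.ofFrobeniusLift hp htf φ hφ).delta x :=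
  (hφ x).choose_spec

/-! ### `p`-completion -/

/-- The (classical) `p`-adic completion `lim_n R / p ^ n` of a commutative ring. -/
abbrev PCompletion (p : ℕ) (R : Type*) [CommRing R] : Type _ :=
  AdicCompletion (Ideal.span {(p : R)}) R

namespace PCompletion

/-- The completion map `R → R^∧_p`. -/
noncomputable def of (p : ℕ) (R : Type*) [CommRing R] : R →+* PCompletion p R :=
  algebraMap R (PCompletion p R)

/-- The projection `R^∧_p → R / p ^ n`. -/
def proj (p : ℕ) (R : Type*) [CommRing R] (n : ℕ) :
    PCompletion p R →+* R ⧸ ((Ideal.span {(p : R)}) ^ n • ⊤ : Ideal R) where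
  toFun x := x.val n
  map_zero' := rfl
  map_one' := rfl
  map_add' _ _ := rfl
  map_mul' _ _ := rfl

theorem mem_pow_smul_top {p : ℕ} {R : Type*} [CommRing R] {n : ℕ} {x : R} :
    x ∈ ((Ideal.span {(p : R)}) ^ n • ⊤ : Ideal R) ↔ (p : R) ^ n ∣ x := by
  rw [smul_eq_mul, Ideal.mul_top, Ideal.span_singleton_pow, Ideal.mem_span_singleton]

theorem ext_proj {p : ℕ} {R : Type*} [CommRing R] {x y : PCompletion p R}
    (h : ∀ n, proj p R n x = proj p R n y) : x = y :=
  AdicCompletion.ext h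

theorem proj_of {p : ℕ} {R : Type*} [CommRing R] (n : ℕ) (a : R) :
    proj p R n (of p R a) = Ideal.Quotient.mk _ a := rfl

theorem proj_eq_iff {p : ℕ} {R : Type*} [CommRing R] (n : ℕ) (a b : R) :
    proj p R n (of p R a) = proj p R n (of p R b) ↔ (p : R) ^ n ∣ a - b := by
  rw [proj_of, proj_of, Ideal.Quotient.eq, mem_pow_smul_top]

theorem exists_proj_eq {p : ℕ} {R : Type*} [CommRing R] (n : ℕ) (x : PCompletion p R) :
    ∃ a : R, proj p R n x = proj p R n (of p R a) := by
  obtain ⟨a, ha⟩ := Ideal.Quotient.mk_surjective (proj p R n x)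
  exact ⟨a, ha.symm⟩

theorem proj_mono {p : ℕ} {R : Type*} [CommRing R] {m n : ℕ} (h : m ≤ n)
    {x y : PCompletion p R} (hxy : proj p R n x = proj p R n y) :
    proj p R m x = proj p R m y := by
  have hx := x.property h
  have hy := y.property h
  change x.val n = y.val n at hxy
  change x.val m = y.val m
  exact hx.symm.trans ((congrArg _ hxy).trans hy)

/-- The map `R^∧_p → R / p ^ n → S / p ^ n` induced by a ring homomorphism `f : R → S`. -/
noncomputable def mapAux (p : ℕ) {R S : Type*} [CommRing R] [CommRing S] (f : R →+* S) (n : ℕ) :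
    PCompletion p R →+* S ⧸ (Ideal.span {(p : S)}) ^ n :=
  (Ideal.Quotient.lift ((Ideal.span {(p : R)}) ^ n • ⊤ : Ideal R)
    ((Ideal.Quotient.mk ((Ideal.span {(p : S)}) ^ n)).comp f) (fun a ha => by
      rw [mem_pow_smul_top] at ha
      obtain ⟨c, rfl⟩ := ha
      rw [RingHom.comp_apply, Ideal.Quotient.eq_zero_iff_mem, Ideal.span_singleton_pow,
        Ideal.mem_span_singleton]
      exact ⟨f c, by simp⟩)).comp (proj p R n)

theorem mapAux_eq {p : ℕ} {R S : Type*} [CommRing R] [CommRing S] (f : R →+* S) (n : ℕ)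
    (x : PCompletion p R) (a : R) (h : proj p R n x = proj p R n (of p R a)) :
    mapAux p f n x = Ideal.Quotient.mk _ (f a) := by
  rw [mapAux, RingHom.comp_apply, h, proj_of]
  rfl

theorem mapAux_compat (p : ℕ) {R S : Type*} [CommRing R] [CommRing S] (f : R →+* S) {m n : ℕ}
    (hmn : m ≤ n) :
    (Ideal.Quotient.factorPow (Ideal.span {(p : S)}) hmn).comp (mapAux p f n) = mapAux p f m := by
  refine RingHom.ext fun x => ?_
  obtain ⟨a, ha⟩ := exists_proj_eq n x
  rw [RingHom.comp_apply, mapAux_eq f n x a ha, mapAux_eq f m x a (proj_mono hmn ha)]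
  rfl

/-- The map `f^∧_p : R^∧_p → S^∧_p` induced by a ring homomorphism `f : R → S`. -/
noncomputable def map (p : ℕ) {R S : Type*} [CommRing R] [CommRing S] (f : R →+* S) :
    PCompletion p R →+* PCompletion p S :=
  AdicCompletion.liftRingHom (Ideal.span {(p : S)}) (mapAux p f) (mapAux_compat p f)

theorem proj_map {p : ℕ} {R S : Type*} [CommRing R] [CommRing S] (f : R →+* S) (n : ℕ)
    (x : PCompletion p R) (a : R) (h : proj p R n x = proj p R n (of p R a)) :
    proj p S n (map p f x) = proj p S n (of p S (f a)) := by
  have h1 : (AdicCompletion.evalₐ (Ideal.span {(p : S)}) n) (map p f x) =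
      Ideal.Quotient.mk _ (f a) := by
    rw [← mapAux_eq f n x a h]
    exact AdicCompletion.evalₐ_liftRingHom _ (mapAux p f) (mapAux_compat p f) n x
  rw [← AdicCompletion.evalₐ_of] at h1
  have hI : ((Ideal.span {(p : S)}) ^ n • ⊤ : Ideal S) = (Ideal.span {(p : S)}) ^ n := by
    ext x; simp
  exact (Ideal.quotientEquivAlgOfEq S hI).injective h1

/-- The induced map is compatible with the completion maps. -/
theorem map_of {p : ℕ} {R S : Type*} [CommRing R] [CommRing S] (f : R →+* S) (a : R) :
    map p f (of p R a) = of p S (f a) :=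
  ext_proj fun n => proj_map f n _ a rfl

end PCompletion

namespace DeltaRing

theorem pow_dvd_delta {p : ℕ} (hp : p.Prime) {R : Type*} [CommRing R] [DeltaRing p R] (n : ℕ) :
    ∀ x : R, (p : R) ^ (n + 1) ∣ x → (p : R) ^ n ∣ delta p x := by
  induction n with
  | zero => intro x _; simp
  | succ n ih =>
    rintro x ⟨c, rfl⟩
    have h1 := ih ((p : R) ^ (n + 1) * c) ⟨c, rfl⟩
    obtain ⟨d, hd⟩ := h1
    have e : (p : R) ^ (n + 1 + 1) * c = p * ((p : R) ^ (n + 1) * c) := by ring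
    rw [e, delta_mul]
    have hpow : (p : R) ^ (n + 1) ∣ ((p : R) ^ (n + 1) * c) ^ p :=
      dvd_pow (Dvd.intro _ rfl) hp.ne_zero
    refine dvd_add (dvd_add ?_ (hpow.mul_right _)) ?_
    · rw [hd]
      have : (p : R) ∣ (p : R) ^ p := dvd_pow_self _ hp.ne_zero
      rw [pow_succ, mul_comm ((p : R) ^ p)]
      exact (mul_dvd_mul (Dvd.intro _ rfl) this)
    · rw [hd]
      exact ⟨delta p (p : R) * d, by ring⟩

theorem pow_dvd_delta_sub {p : ℕ} (hp : p.Prime) {R : Type*} [CommRing R] [DeltaRing p R]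
    (n : ℕ) (x y : R) (h : (p : R) ^ (n + 1) ∣ x - y) :
    (p : R) ^ n ∣ delta p x - delta p y := by
  have h1 := delta_add (p := p) (x - y) y
  rw [sub_add_cancel] at h1
  rw [h1]
  have h2 := pow_dvd_delta hp n _ h
  have h3 : (p : R) ^ n ∣ ∑ i ∈ Finset.Ioo 0 p,
      ((p.choose i / p : ℕ) : R) * (x - y) ^ i * y ^ (p - i) := by
    refine Finset.dvd_sum fun i hi => ?_
    rw [Finset.mem_Ioo] at hi
    exact ((dvd_pow ((pow_dvd_pow _ n.le_succ).trans h) hi.1.ne').mul_left _).mul_right _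
  have e : delta p (x - y) + delta p y - ∑ i ∈ Finset.Ioo 0 p,
      ((p.choose i / p : ℕ) : R) * (x - y) ^ i * y ^ (p - i) - delta p y =
      delta p (x - y) - ∑ i ∈ Finset.Ioo 0 p,
      ((p.choose i / p : ℕ) : R) * (x - y) ^ i * y ^ (p - i) := by ring
  rw [e]
  exact dvd_sub h2 h3

/-- The extension of `δ_p` to the `p`-completion: `δ_p(x)` modulo `p ^ n` is computed from a lift
of `x` modulo `p ^ (n + 1)`. -/
noncomputable def deltaCompletion {p : ℕ} (hp : p.Prime) {R : Type*} [CommRing R] [DeltaRing p R]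
    (x : PCompletion p R) : PCompletion p R :=
  ⟨fun n => Ideal.Quotient.mk _ (delta p (PCompletion.exists_proj_eq (n + 1) x).choose), by
    intro m n hmn
    change Ideal.Quotient.mk _ _ = Ideal.Quotient.mk _ _
    rw [Ideal.Quotient.eq, PCompletion.mem_pow_smul_top]
    refine pow_dvd_delta_sub hp m _ _ ((PCompletion.proj_eq_iff (m + 1) _ _).1 ?_)
    rw [← (PCompletion.exists_proj_eq (m + 1) x).choose_spec]
    exact (PCompletion.proj_mono (Nat.succ_le_succ hmn)
      (PCompletion.exists_proj_eq (n + 1) x).choose_spec).symm⟩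

theorem proj_deltaCompletion {p : ℕ} (hp : p.Prime) {R : Type*} [CommRing R] [DeltaRing p R]
    (n : ℕ) (x : PCompletion p R) (a : R)
    (h : PCompletion.proj p R (n + 1) x =
      PCompletion.proj p R (n + 1) (PCompletion.of p R a)) :
    PCompletion.proj p R n (deltaCompletion hp x) =
      PCompletion.proj p R n (PCompletion.of p R (delta p a)) := by
  change Ideal.Quotient.mk _ _ = Ideal.Quotient.mk _ _
  rw [Ideal.Quotient.eq, PCompletion.mem_pow_smul_top]
  refine pow_dvd_delta_sub hp n _ _ ((PCompletion.proj_eq_iff (n + 1) _ _).1 ?_)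
  rw [← (PCompletion.exists_proj_eq (n + 1) x).choose_spec, h]

/-- On the image of `R` the extended operation is the original one. -/
theorem deltaCompletion_of {p : ℕ} (hp : p.Prime) {R : Type*} [CommRing R] [DeltaRing p R]
    (a : R) : deltaCompletion hp (PCompletion.of p R a) = PCompletion.of p R (delta p a) :=
  PCompletion.ext_proj fun n => proj_deltaCompletion hp n _ a rfl

/-- The `δ_p`-structure on the `p`-completion of a `δ_p`-ring. -/
@[reducible]
noncomputable def completion {p : ℕ} (hp : p.Prime) (R : Type*) [CommRing R] [DeltaRing p R] :
    DeltaRing p (PCompletion p R) where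
  delta := deltaCompletion hp
  delta_zero := by
    have h := deltaCompletion_of hp (0 : R)
    rwa [delta_zero, map_zero] at h
  delta_one := by
    have h := deltaCompletion_of hp (1 : R)
    rwa [delta_one, map_zero, map_one] at h
  delta_add x y := by
    refine PCompletion.ext_proj fun n => ?_
    obtain ⟨a, ha⟩ := PCompletion.exists_proj_eq (n + 1) x
    obtain ⟨b, hb⟩ := PCompletion.exists_proj_eq (n + 1) y
    have ha' := PCompletion.proj_mono n.le_succ ha
    have hb' := PCompletion.proj_mono n.le_succ hb
    rw [proj_deltaCompletion hp n (x + y) (a + b) (by simp only [map_add, ha, hb]), delta_add]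
    simp only [map_add, map_sub, map_sum, map_mul, map_pow, map_natCast,
      proj_deltaCompletion hp n x a ha, proj_deltaCompletion hp n y b hb, ha', hb']
  delta_mul x y := by
    refine PCompletion.ext_proj fun n => ?_
    obtain ⟨a, ha⟩ := PCompletion.exists_proj_eq (n + 1) x
    obtain ⟨b, hb⟩ := PCompletion.exists_proj_eq (n + 1) y
    have ha' := PCompletion.proj_mono n.le_succ ha
    have hb' := PCompletion.proj_mono n.le_succ hb
    rw [proj_deltaCompletion hp n (x * y) (a * b) (by simp only [map_mul, ha, hb]), delta_mul]
    simp only [map_add, map_mul, map_pow, map_natCast,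
      proj_deltaCompletion hp n x a ha, proj_deltaCompletion hp n y b hb, ha', hb']

theorem map_deltaCompletion {p : ℕ} (hp : p.Prime) {R S : Type*} [CommRing R] [CommRing S]
    [DeltaRing p R] [DeltaRing p S] (f : R →+* S)
    (hf : ∀ a, f (delta p a) = delta p (f a)) (x : PCompletion p R) :
    PCompletion.map p f (deltaCompletion hp x) = deltaCompletion hp (PCompletion.map p f x) := by
  refine PCompletion.ext_proj fun n => ?_
  obtain ⟨a, ha⟩ := PCompletion.exists_proj_eq (n + 1) x
  rw [PCompletion.proj_map f n _ _ (proj_deltaCompletion hp n x a ha),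
    proj_deltaCompletion hp n _ _ (PCompletion.proj_map f (n + 1) x a ha), hf]

end DeltaRing

/-! ### `δ̂`-rings -/

/-- A `δ̂`-ring (of bounded torsion): a commutative ring `R` with bounded `p`-power torsion for
every prime `p`, together with a `δ_p`-structure on the `p`-completion of `R` for every prime `p`.
There is no compatibility between different primes.  Bounded torsion guarantees that the derived
`p`-completion of `R` is the classical one. -/
class DeltaHatRing (R : Type*) [CommRing R] where
  bounded_torsion : ∀ p : ℕ, p.Prime →
    ∃ n : ℕ, ∀ (k : ℕ) (x : R), (p : R) ^ k * x = 0 → (p : R) ^ n * x = 0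
  deltaRing : ∀ p : ℕ, p.Prime → DeltaRing p (PCompletion p R)

/-- The operation `δ_p` on the `p`-completion of a `δ̂`-ring. -/
def DeltaHatRing.delta {R : Type*} [CommRing R] [DeltaHatRing R] {p : ℕ} (hp : p.Prime) :
    PCompletion p R → PCompletion p R :=
  (DeltaHatRing.deltaRing p hp).delta

/-- A morphism of `δ̂`-rings: a ring homomorphism whose `p`-completion commutes with `δ_p` for
every prime `p`. -/
@[ext]
structure DeltaHatHom (R S : Type*) [CommRing R] [CommRing S] [DeltaHatRing R] [DeltaHatRing S]
    where
  toRingHom : R →+* S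
  map_delta : ∀ (p : ℕ) (hp : p.Prime) (x : PCompletion p R),
    PCompletion.map p toRingHom (DeltaHatRing.delta hp x) =
      DeltaHatRing.delta hp (PCompletion.map p toRingHom x)

/-- The group of rank `1` units of a `δ̂`-ring, described as the subgroup of those units `t` whose
image in the `p`-completion is killed by `δ_p` for every prime `p`. -/
def rankOneUnits (R : Type*) [CommRing R] [DeltaHatRing R] : Subgroup Rˣ where
  carrier := {t | ∀ (p : ℕ) (hp : p.Prime),
    DeltaHatRing.delta hp (PCompletion.of p R (t : R)) = 0}
  one_mem' := fun p hp => by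
    rw [Units.val_one, map_one]; exact (DeltaHatRing.deltaRing p hp).delta_one
  mul_mem' := fun {s t} hs ht p hp => by
    rw [Units.val_mul, map_mul]
    refine ((DeltaHatRing.deltaRing p hp).delta_mul _ _).trans ?_
    have h1 := hs p hp
    have h2 := ht p hp
    unfold DeltaHatRing.delta at h1 h2
    rw [h1, h2]; ring
  inv_mem' := fun {t} ht p hp => by
    have h1 := ht p hp
    unfold DeltaHatRing.delta at h1 ⊢
    have h := (DeltaHatRing.deltaRing p hp).delta_mul
      (PCompletion.of p R (t : R)) (PCompletion.of p R ((t⁻¹ : Rˣ) : R))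
    rw [← map_mul, Units.mul_inv, map_one, (DeltaHatRing.deltaRing p hp).delta_one, h1,
      mul_zero, mul_zero, zero_mul, add_zero, add_zero] at h
    have hu : IsUnit (PCompletion.of p R (t : R) ^ p) := (t.isUnit.map _).pow p
    exact (hu.mul_right_eq_zero).1 h.symm

/-! ### Group rings -/

namespace GroupRing

/-- The endomorphism `[m] ↦ [p m]` of the group ring `ℤ[M]`. -/
noncomputable def frobenius (p : ℕ) (M : Type*) [AddCommGroup M] :
    AddMonoidAlgebra ℤ M →+* AddMonoidAlgebra ℤ M :=
  AddMonoidAlgebra.mapDomainRingHom ℤ (p • AddMonoidHom.id M)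

theorem eq_zero_of_mul_eq_zero {M : Type*} [AddCommGroup M] {n : ℕ} (hn : n ≠ 0)
    (x : AddMonoidAlgebra ℤ M) (h : (n : AddMonoidAlgebra ℤ M) * x = 0) : x = 0 := by
  rw [← nsmul_eq_mul] at h
  ext m
  have h1 := congrArg (fun y : AddMonoidAlgebra ℤ M => y.coeff m) h
  rw [AddMonoidAlgebra.coeff_smul, Finsupp.smul_apply, AddMonoidAlgebra.coeff_zero,
    Finsupp.zero_apply, nsmul_eq_mul, mul_eq_zero] at h1
  exact h1.resolve_left (Nat.cast_ne_zero.2 hn)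

theorem exists_frobenius_eq {p : ℕ} (hp : p.Prime) {M : Type*} [AddCommGroup M]
    (x : AddMonoidAlgebra ℤ M) :
    ∃ d : AddMonoidAlgebra ℤ M, frobenius p M x = x ^ p + p * d := by
  induction x using AddMonoidAlgebra.induction_linear with
  | zero => exact ⟨0, by simp [hp.ne_zero]⟩
  | add x y hx hy =>
    obtain ⟨c, hc⟩ := hx
    obtain ⟨d, hd⟩ := hy
    rw [map_add, hc, hd, add_pow_eq_add_prime_mul hp]
    exact ⟨c + d - ∑ i ∈ Finset.Ioo 0 p,
      ((p.choose i / p : ℕ) : AddMonoidAlgebra ℤ M) * x ^ i * y ^ (p - i), by ring⟩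
  | single m a =>
    have := Fact.mk hp
    have h : (p : ℤ) ∣ a - a ^ p := by
      rw [← ZMod.intCast_zmod_eq_zero_iff_dvd]
      push_cast
      rw [ZMod.pow_card, sub_self]
    obtain ⟨b, hb⟩ := h
    refine ⟨AddMonoidAlgebra.single (p • m) b, ?_⟩
    rw [AddMonoidAlgebra.single_pow, ← nsmul_eq_mul, AddMonoidAlgebra.smul_single,
      ← AddMonoidAlgebra.single_add]
    have e : a ^ p + p • b = a := by rw [nsmul_eq_mul]; linarith
    rw [e]
    simp [frobenius]

/-- The `δ_p`-structure on `ℤ[M]` with Frobenius lift `[m] ↦ [p m]`. -/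
@[reducible]
noncomputable def deltaRing {p : ℕ} (hp : p.Prime) (M : Type*) [AddCommGroup M] :
    DeltaRing p (AddMonoidAlgebra ℤ M) :=
  DeltaRing.ofFrobeniusLift hp (eq_zero_of_mul_eq_zero hp.ne_zero) (frobenius p M)
    (exists_frobenius_eq hp)

/-- The `δ̂`-structure on `ℤ[M]`: for every prime `p`, the `p`-completion carries the extension of
the `δ_p`-structure of `ℤ[M]`. -/
noncomputable instance deltaHatRing (M : Type*) [AddCommGroup M] :
    DeltaHatRing (AddMonoidAlgebra ℤ M) where
  bounded_torsion p hp := ⟨0, fun k x h => by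
    rw [pow_zero, one_mul]
    refine eq_zero_of_mul_eq_zero (pow_ne_zero k hp.ne_zero) x ?_
    rw [Nat.cast_pow]; exact h⟩
  deltaRing p hp :=
    letI := deltaRing hp M
    DeltaRing.completion hp (AddMonoidAlgebra ℤ M)

theorem mapDomain_delta {p : ℕ} (hp : p.Prime) {N M : Type*} [AddCommGroup N] [AddCommGroup M]
    (f : N →+ M) (x : AddMonoidAlgebra ℤ N) :
    AddMonoidAlgebra.mapDomainRingHom ℤ f ((deltaRing hp N).delta x) =
      (deltaRing hp M).delta (AddMonoidAlgebra.mapDomainRingHom ℤ f x) := by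
  have hN := DeltaRing.ofFrobeniusLift_spec hp (eq_zero_of_mul_eq_zero hp.ne_zero)
    (frobenius p N) (exists_frobenius_eq hp) x
  have hM := DeltaRing.ofFrobeniusLift_spec hp (eq_zero_of_mul_eq_zero hp.ne_zero)
    (frobenius p M) (exists_frobenius_eq hp) (AddMonoidAlgebra.mapDomainRingHom ℤ f x)
  have hc : AddMonoidAlgebra.mapDomainRingHom ℤ f (frobenius p N x) =
      frobenius p M (AddMonoidAlgebra.mapDomainRingHom ℤ f x) := by
    unfold frobenius
    rw [← RingHom.comp_apply, ← RingHom.comp_apply, ← AddMonoidAlgebra.mapDomainRingHom_comp,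
      ← AddMonoidAlgebra.mapDomainRingHom_comp]
    congr 2
    ext n
    simp
  refine sub_eq_zero.1 (eq_zero_of_mul_eq_zero hp.ne_zero _ ?_)
  have h1 := congrArg (AddMonoidAlgebra.mapDomainRingHom ℤ f) hN
  rw [map_add, map_mul, map_pow, map_natCast] at h1
  unfold deltaRing
  linear_combination hc - h1 + hM

/-- The morphism of `δ̂`-rings `ℤ[N] → ℤ[M]`, `[n] ↦ [f n]`, induced by a homomorphism of abelian
groups `f : N → M`. -/
noncomputable def deltaHatMap {N M : Type*} [AddCommGroup N] [AddCommGroup M] (f : N →+ M) :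
    DeltaHatHom (AddMonoidAlgebra ℤ N) (AddMonoidAlgebra ℤ M) where
  toRingHom := AddMonoidAlgebra.mapDomainRingHom ℤ f
  map_delta _ hp x :=
    letI := deltaRing hp N
    letI := deltaRing hp M
    DeltaRing.map_deltaCompletion hp _ (mapDomain_delta hp f) x

end GroupRing

/-! Everything reduces to showing that a rank 1 unit `u` of `ℤ[M]` is a group element, and the prime
2 alone forces this. Since `ℤ[M]` has no 2-torsion and embeds in its 2-completion, `δ_2(u) = 0`
means `φ_2(u) = u ^ 2` (`delta_of_eq_zero_iff`). Let `x = u ū`, where the bar is `[m] ↦ [-m]`. Then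
`x` is selfadjoint, `φ_2(x) = x ^ 2`, and its coefficient at `0` is the sum of the squares of the
coefficients of `u`. The powers `x ^ (2 ^ k) = φ_2 ^ k (x)` have bounded ℓ¹ norm, whereas a
coefficient at `0` exceeding 1 would grow without bound under repeated squaring
(`coeff_zero_le_one`). So that sum of squares is at most 1, `u = a[m]`, and `a = a ^ 2` gives `a =
1`. A `δ̂`-map out of `ℤ[N]` sends each `[n]` to a rank 1 unit, hence to a group element, so it
comes from a homomorphism `N → M`. -/

namespace GroupRing

/-! ### The ℓ¹ norm on the group ring. -/

variable {M : Type*}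

/-- The sum of the absolute values of the coefficients. -/
def lOneNorm (x : AddMonoidAlgebra ℤ M) : ℤ := x.coeff.sum fun _ a => |a|

theorem lOneNorm_zero : lOneNorm (0 : AddMonoidAlgebra ℤ M) = 0 := by
  simp [lOneNorm]

theorem lOneNorm_single (m : M) (a : ℤ) : lOneNorm (AddMonoidAlgebra.single m a) = |a| := by
  simp [lOneNorm]

theorem lOneNorm_eq_sum {x : AddMonoidAlgebra ℤ M} {s : Finset M} (hs : x.coeff.support ⊆ s) :
    lOneNorm x = ∑ m ∈ s, |x.coeff m| :=
  Finsupp.sum_of_support_subset _ hs _ fun _ _ => abs_zero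

theorem lOneNorm_add_le (x y : AddMonoidAlgebra ℤ M) :
    lOneNorm (x + y) ≤ lOneNorm x + lOneNorm y := by
  classical
  rw [lOneNorm_eq_sum (x := x) Finset.subset_union_left,
    lOneNorm_eq_sum (x := y) Finset.subset_union_right,
    lOneNorm_eq_sum (x := x + y) (s := x.coeff.support ∪ y.coeff.support)
      (by rw [AddMonoidAlgebra.coeff_add]; exact Finsupp.support_add),
    ← Finset.sum_add_distrib]
  refine Finset.sum_le_sum fun m _ => ?_
  rw [AddMonoidAlgebra.coeff_add, Finsupp.add_apply]
  exact abs_add_le _ _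

theorem lOneNorm_sum_le {ι : Type*} (s : Finset ι) (f : ι → AddMonoidAlgebra ℤ M) :
    lOneNorm (∑ i ∈ s, f i) ≤ ∑ i ∈ s, lOneNorm (f i) :=
  Finset.le_sum_of_subadditive _ lOneNorm_zero.le lOneNorm_add_le _ _

theorem abs_coeff_le_lOneNorm (x : AddMonoidAlgebra ℤ M) (m : M) : |x.coeff m| ≤ lOneNorm x := by
  by_cases h : m ∈ x.coeff.support
  · exact Finset.single_le_sum (f := fun m => |x.coeff m|) (fun _ _ => abs_nonneg _) h
  · rw [Finsupp.notMem_support_iff.1 h, abs_zero]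
    exact Finset.sum_nonneg fun _ _ => abs_nonneg _

theorem sum_coeff_single (x : AddMonoidAlgebra ℤ M) :
    ∑ m ∈ x.coeff.support, AddMonoidAlgebra.single m (x.coeff m) = x := by
  ext n
  classical
  simp [AddMonoidAlgebra.coeff_sum, Finsupp.finsetSum_apply, Finsupp.single_apply, eq_comm]

/-! ### Frobenius lifts, the involution and the coefficient at `0`. -/

variable [AddCommGroup M]

theorem frobenius_single (p : ℕ) (m : M) (a : ℤ) :
    frobenius p M (AddMonoidAlgebra.single m a) = AddMonoidAlgebra.single (p • m) a := by
  simp [frobenius]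

/-- Coefficients are only moved along `m ↦ p m`. The norm can drop when `M` has `p`-torsion, because
colliding terms may cancel. -/
theorem lOneNorm_frobenius_le (p : ℕ) (x : AddMonoidAlgebra ℤ M) :
    lOneNorm (frobenius p M x) ≤ lOneNorm x := by
  conv_lhs => rw [← sum_coeff_single x, map_sum]
  refine (lOneNorm_sum_le _ _).trans (le_of_eq (Finset.sum_congr rfl fun m _ => ?_))
  rw [frobenius_single, lOneNorm_single]

/-- The involution `[m] ↦ [-m]` of the group ring `ℤ[M]`. -/
noncomputable def involution (M : Type*) [AddCommGroup M] :
    AddMonoidAlgebra ℤ M →+* AddMonoidAlgebra ℤ M :=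
  AddMonoidAlgebra.mapDomainRingHom ℤ (-AddMonoidHom.id M)

theorem involution_single (m : M) (a : ℤ) :
    involution M (AddMonoidAlgebra.single m a) = AddMonoidAlgebra.single (-m) a := by
  simp [involution]

theorem involution_involution (x : AddMonoidAlgebra ℤ M) : involution M (involution M x) = x := by
  rw [← sum_coeff_single x]
  simp only [map_sum, involution_single, neg_neg]

theorem involution_frobenius (p : ℕ) (x : AddMonoidAlgebra ℤ M) :
    involution M (frobenius p M x) = frobenius p M (involution M x) := by
  rw [← sum_coeff_single x]
  simp only [map_sum, involution_single, frobenius_single, smul_neg]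

/-- In the expansion over pairs `[m - n]`, only the diagonal contributes at `0`. -/
theorem coeff_zero_mul_involution (x : AddMonoidAlgebra ℤ M) :
    (x * involution M x).coeff 0 = ∑ m ∈ x.coeff.support, x.coeff m ^ 2 := by
  classical
  have h : x * involution M x = ∑ m ∈ x.coeff.support, ∑ n ∈ x.coeff.support,
      AddMonoidAlgebra.single (m - n) (x.coeff m * x.coeff n) := by
    conv_lhs => rw [← sum_coeff_single x]
    rw [map_sum, Finset.sum_mul_sum]
    simp only [involution_single, AddMonoidAlgebra.single_mul_single, sub_eq_add_neg]
  rw [h, AddMonoidAlgebra.coeff_sum, Finsupp.finsetSum_apply]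
  refine Finset.sum_congr rfl fun m hm => ?_
  rw [AddMonoidAlgebra.coeff_sum, Finsupp.finsetSum_apply, Finset.sum_eq_single_of_mem m hm]
  · simp [sq]
  · intro n _ hn
    simp [sub_eq_zero, hn.symm]

/-- For selfadjoint `x`, the square is `x` times its involute, so the right side is a sum of squares
that dominates the term at `0`. -/
theorem sq_coeff_zero_le {x : AddMonoidAlgebra ℤ M} (hx : involution M x = x) :
    x.coeff 0 ^ 2 ≤ (x ^ 2).coeff 0 := by
  have h := coeff_zero_mul_involution x
  rw [hx, ← sq] at h
  rw [h]
  by_cases h0 : (0 : M) ∈ x.coeff.support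
  · exact Finset.single_le_sum (f := fun m => x.coeff m ^ 2) (fun _ _ => sq_nonneg _) h0
  · rw [Finsupp.notMem_support_iff.1 h0]
    exact Finset.sum_nonneg fun _ _ => by positivity

/-! ### Elements on which `φ_2` is squaring. -/

/-- The coefficient of a selfadjoint element at `0` is at most `1` if squaring the element agrees
with `φ_2`: its iterated squares have bounded coefficients. -/
theorem coeff_zero_le_one {x : AddMonoidAlgebra ℤ M} (hx : involution M x = x)
    (h2 : frobenius 2 M x = x ^ 2) : x.coeff 0 ≤ 1 := by
  by_contra! hlt
  have hpow : ∀ k : ℕ, lOneNorm (x ^ 2 ^ k) ≤ lOneNorm x ∧ (2 : ℤ) ^ k < (x ^ 2 ^ k).coeff 0 := by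
    intro k
    induction k with
    | zero => simpa using hlt
    | succ k ih =>
      have hφ : x ^ 2 ^ (k + 1) = frobenius 2 M (x ^ 2 ^ k) := by
        rw [map_pow, h2, ← pow_mul, ← pow_succ']
      refine ⟨by rw [hφ]; exact (lOneNorm_frobenius_le 2 _).trans ih.1, ?_⟩
      have h := sq_coeff_zero_le (x := x ^ 2 ^ k) (by rw [map_pow, hx])
      rw [← pow_mul, ← pow_succ] at h
      have h1 : (1 : ℤ) ≤ 2 ^ k := one_le_pow₀ (by norm_num)
      rw [pow_succ]
      -- By integrality the coefficient is at least `2 ^ k + 1`, and `(2 ^ k + 1) ^ 2 > 2 ^ (k +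
      -- 1)`.
      nlinarith [ih.2]
  -- With `k` equal to the norm itself, `k < 2 ^ k` already contradicts the bound.
  obtain ⟨h1, h3⟩ := hpow (lOneNorm x).toNat
  have h4 := (le_abs_self _).trans ((abs_coeff_le_lOneNorm _ 0).trans h1)
  have h5 : ((lOneNorm x).toNat : ℤ) < 2 ^ (lOneNorm x).toNat := by
    exact_mod_cast Nat.lt_two_pow_self
  have h6 := Int.self_le_toNat (lOneNorm x)
  omega

/-- A nonzero element of `ℤ[M]` whose square is its image under `φ_2` is a group element. -/
theorem exists_eq_single_of_frobenius_two {u : AddMonoidAlgebra ℤ M} (hu : u ≠ 0)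
    (h2 : frobenius 2 M u = u ^ 2) : ∃ m : M, u = AddMonoidAlgebra.single m 1 := by
  have hle : ∑ m ∈ u.coeff.support, u.coeff m ^ 2 ≤ 1 := by
    rw [← coeff_zero_mul_involution]
    refine coeff_zero_le_one ?_ ?_
    · rw [map_mul, involution_involution, mul_comm]
    · rw [map_mul, ← involution_frobenius, h2, map_pow, mul_pow]
  -- Each nonzero integer coefficient contributes at least 1 to the sum of squares.
  have hcard : (u.coeff.support.card : ℤ) ≤ 1 := by
    refine le_trans ?_ hle
    rw [Finset.card_eq_sum_ones, Nat.cast_sum]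
    refine Finset.sum_le_sum fun m hm => ?_
    have h : 0 < u.coeff m ^ 2 := by
      have := Finsupp.mem_support_iff.1 hm
      positivity
    exact_mod_cast h
  obtain ⟨m, hm⟩ : ∃ m, u = AddMonoidAlgebra.single m (u.coeff m) := by
    rcases Nat.le_one_iff_eq_zero_or_eq_one.1 (by exact_mod_cast hcard) with h | h
    · refine absurd ?_ hu
      rw [← sum_coeff_single u, Finset.card_eq_zero.1 h, Finset.sum_empty]
    · obtain ⟨m, hm⟩ := Finset.card_eq_one.1 h
      refine ⟨m, ?_⟩
      conv_lhs => rw [← sum_coeff_single u, hm, Finset.sum_singleton]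
  generalize u.coeff m = a at hm
  subst hm
  have ha0 : a ≠ 0 := by
    rintro rfl
    exact hu (AddMonoidAlgebra.single_zero m)
  rw [frobenius_single, AddMonoidAlgebra.single_pow] at h2
  -- The coefficients at `2 • m` give `a = a ^ 2`, which rules out `-[m]`.
  have h3 := congrArg (fun y : AddMonoidAlgebra ℤ M => y.coeff (2 • m)) h2
  simp only [AddMonoidAlgebra.coeff_single, Finsupp.single_eq_same] at h3
  have ha : a = 1 := mul_left_cancel₀ ha0 (by rw [← sq, ← h3, mul_one])
  exact ⟨m, by rw [ha]⟩

/-! ### From `δ_p = 0` in the completion to an equation in `ℤ[M]`. -/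

/-- Coefficients of an element of the kernel are integers divisible by every power of `p`. -/
theorem of_injective {p : ℕ} (hp : p.Prime) :
    Function.Injective (PCompletion.of p (AddMonoidAlgebra ℤ M)) := by
  rw [injective_iff_map_eq_zero]
  intro x hx
  ext m
  have hdvd : ∀ n : ℕ, (p : ℤ) ^ n ∣ x.coeff m := fun n => by
    have h := (PCompletion.proj_eq_iff (p := p) n x 0).1 (by simp only [hx, map_zero])
    rw [sub_zero] at h
    obtain ⟨c, rfl⟩ := h
    rw [← Nat.cast_pow (α := AddMonoidAlgebra ℤ M), ← nsmul_eq_mul, AddMonoidAlgebra.coeff_smul,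
      Finsupp.smul_apply, nsmul_eq_mul, Nat.cast_pow]
    exact Dvd.intro _ rfl
  rw [AddMonoidAlgebra.coeff_zero, Finsupp.zero_apply]
  by_contra h0
  have hf : FiniteMultiplicity (p : ℤ) (x.coeff m) :=
    Int.finiteMultiplicity_iff.2 ⟨by simpa using hp.ne_one, h0⟩
  obtain ⟨n, hn⟩ := hf
  exact hn (hdvd _)

theorem delta_of {p : ℕ} (hp : p.Prime) (x : AddMonoidAlgebra ℤ M) :
    DeltaHatRing.delta hp (PCompletion.of p (AddMonoidAlgebra ℤ M) x) =
      PCompletion.of p (AddMonoidAlgebra ℤ M) ((deltaRing hp M).delta x) :=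
  letI := deltaRing hp M
  DeltaRing.deltaCompletion_of hp x

/-- Vanishing descends to `ℤ[M]` by injectivity, and there `p δ_p(x) = φ_p(x) - x ^ p` with no
`p`-torsion. -/
theorem delta_of_eq_zero_iff {p : ℕ} (hp : p.Prime) (x : AddMonoidAlgebra ℤ M) :
    DeltaHatRing.delta hp (PCompletion.of p (AddMonoidAlgebra ℤ M) x) = 0 ↔
      frobenius p M x = x ^ p := by
  have h := DeltaRing.ofFrobeniusLift_spec hp (eq_zero_of_mul_eq_zero hp.ne_zero)
    (frobenius p M) (exists_frobenius_eq hp) x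
  rw [delta_of, map_eq_zero_iff _ (of_injective hp)]
  constructor
  · intro h0
    unfold deltaRing at h0
    rw [h, h0, mul_zero, add_zero]
  · intro h0
    rw [h0, left_eq_add] at h
    exact eq_zero_of_mul_eq_zero hp.ne_zero _ h

theorem delta_of_single {p : ℕ} (hp : p.Prime) (m : M) :
    DeltaHatRing.delta hp (PCompletion.of p (AddMonoidAlgebra ℤ M)
      (AddMonoidAlgebra.single m 1)) = 0 := by
  rw [delta_of_eq_zero_iff, frobenius_single, AddMonoidAlgebra.single_pow, one_pow]

theorem single_one_injective :
    Function.Injective fun m : M => (AddMonoidAlgebra.single m 1 : AddMonoidAlgebra ℤ M) :=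
  AddMonoidAlgebra.of_injective

/-! ### Rank 1 units and `δ̂`-maps between group rings. -/

/-- The unit `[m]` of the group ring `ℤ[M]`. -/
noncomputable def unitOf (M : Type*) [AddCommGroup M] :
    Multiplicative M →* (AddMonoidAlgebra ℤ M)ˣ :=
  (AddMonoidAlgebra.of ℤ M).toHomUnits

theorem exists_eq_single_of_mem_rankOneUnits {u : (AddMonoidAlgebra ℤ M)ˣ}
    (hu : u ∈ rankOneUnits (AddMonoidAlgebra ℤ M)) :
    ∃ m : M, (u : AddMonoidAlgebra ℤ M) = AddMonoidAlgebra.single m 1 :=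
  exists_eq_single_of_frobenius_two u.ne_zero
    ((delta_of_eq_zero_iff Nat.prime_two _).1 (hu 2 Nat.prime_two))

theorem unitOf_mem_rankOneUnits (m : Multiplicative M) :
    unitOf M m ∈ rankOneUnits (AddMonoidAlgebra ℤ M) :=
  fun _ hp => delta_of_single hp m.toAdd

/-- The group `M` is the group of rank `1` units of `ℤ[M]`. -/
noncomputable def rankOneUnitsEquiv (M : Type*) [AddCommGroup M] :
    Multiplicative M ≃* rankOneUnits (AddMonoidAlgebra ℤ M) :=
  MulEquiv.ofBijective ((unitOf M).codRestrict _ unitOf_mem_rankOneUnits) <| by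
    constructor
    · intro m n h
      exact single_one_injective (M := M) (congrArg (fun u : rankOneUnits (AddMonoidAlgebra ℤ M) =>
        ((u : (AddMonoidAlgebra ℤ M)ˣ) : AddMonoidAlgebra ℤ M)) h)
    · rintro ⟨u, hu⟩
      obtain ⟨m, hm⟩ := exists_eq_single_of_mem_rankOneUnits hu
      exact ⟨Multiplicative.ofAdd m, Subtype.ext (Units.ext hm.symm)⟩

/-- Each `[n]` is killed by `δ_p`, and `g` commutes with `δ_p` after completion. -/
theorem map_unitOf_mem_rankOneUnits {N R : Type*} [AddCommGroup N] [CommRing R] [DeltaHatRing R]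
    (g : DeltaHatHom (AddMonoidAlgebra ℤ N) R) (n : Multiplicative N) :
    Units.map (g.toRingHom : AddMonoidAlgebra ℤ N →* R) (unitOf N n) ∈ rankOneUnits R := by
  intro p hp
  have h := g.map_delta p hp (PCompletion.of p _ (AddMonoidAlgebra.single n.toAdd 1))
  rw [delta_of_single, map_zero, PCompletion.map_of] at h
  exact h.symm

theorem deltaHatMap_single {N : Type*} [AddCommGroup N] (f : N →+ M) (n : N) :
    (deltaHatMap f).toRingHom (AddMonoidAlgebra.single n 1) =
      AddMonoidAlgebra.single (f n) 1 := by
  simp [deltaHatMap]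

theorem deltaHatMap_bijective (N M : Type*) [AddCommGroup N] [AddCommGroup M] :
    Function.Bijective fun f : N →+ M => deltaHatMap f := by
  constructor
  · intro f g h
    ext n
    have h1 := congrArg (fun k => DeltaHatHom.toRingHom k (AddMonoidAlgebra.single n 1)) h
    simp only [deltaHatMap_single] at h1
    exact single_one_injective h1
  · intro g
    -- Restricting `g` to group elements lands in the rank 1 units, which are identified with `M`.
    let k : Multiplicative N →* Multiplicative M :=
      (rankOneUnitsEquiv M).symm.toMonoidHom.comp
        (((Units.map (g.toRingHom : AddMonoidAlgebra ℤ N →* AddMonoidAlgebra ℤ M)).comp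
          (unitOf N)).codRestrict _ (map_unitOf_mem_rankOneUnits g))
    have hk : ∀ n, AddMonoidAlgebra.single (k n).toAdd 1 =
        g.toRingHom (AddMonoidAlgebra.single n.toAdd 1) := fun n =>
      congrArg (fun u : rankOneUnits (AddMonoidAlgebra ℤ M) =>
        ((u : (AddMonoidAlgebra ℤ M)ˣ) : AddMonoidAlgebra ℤ M))
        ((rankOneUnitsEquiv M).apply_symm_apply _)
    refine ⟨AddMonoidHom.toMultiplicative.symm k, DeltaHatHom.ext ?_⟩
    -- Ring maps out of `ℤ[N]` agree automatically on `ℤ`, so only the elements `[n]` matter.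
    refine AddMonoidAlgebra.ringHom_ext' (RingHom.ext_int _ _) (MonoidHom.ext fun n => ?_)
    exact (deltaHatMap_single _ n.toAdd).trans (hk n)

end GroupRing

theorem mainTheorem9 {N : Type*} {M : Type*} [AddCommGroup N] [AddCommGroup M]
    [AddGroup.FG N] [AddGroup.FG M] :
    -- group homomorphisms `N → M` are the same as `δ̂`-ring maps `ℤ[N] → ℤ[M]`
    Function.Bijective (fun f : N →+ M => GroupRing.deltaHatMap f) ∧
    -- `M` is the set of `δ̂`-ring maps `ℤ[t, t⁻¹] = ℤ[ℤ] → ℤ[M]`, with `m` giving `t ↦ [m]`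
    Function.Bijective (fun m : M => GroupRing.deltaHatMap (zmultiplesHom M m)) ∧
    -- evaluation at `t` identifies these maps with the units killed by all `δ_p`
    (∀ u : (AddMonoidAlgebra ℤ M)ˣ, u ∈ rankOneUnits (AddMonoidAlgebra ℤ M) ↔
      ∃ g : DeltaHatHom (AddMonoidAlgebra ℤ ℤ) (AddMonoidAlgebra ℤ M),
        g.toRingHom (AddMonoidAlgebra.single 1 1) = u) ∧
    -- `m ↦ [m]` is an isomorphism of groups from `M` to the group of rank `1` units
    ∃ e : Multiplicative M ≃* rankOneUnits (AddMonoidAlgebra ℤ M),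
      ∀ m : M, ((e (Multiplicative.ofAdd m) : (AddMonoidAlgebra ℤ M)ˣ) : AddMonoidAlgebra ℤ M) =
        AddMonoidAlgebra.single m 1 := by
  refine ⟨GroupRing.deltaHatMap_bijective N M,
    -- This is the case `N = ℤ`, combined with `M ≃ Hom(ℤ, M)`.
    (GroupRing.deltaHatMap_bijective ℤ M).comp (zmultiplesHom M).bijective, fun u => ⟨?_, ?_⟩,
    GroupRing.rankOneUnitsEquiv M, fun _ => rfl⟩
  · intro hu
    obtain ⟨m, hm⟩ := GroupRing.exists_eq_single_of_mem_rankOneUnits hu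
    refine ⟨GroupRing.deltaHatMap (zmultiplesHom M m), ?_⟩
    rw [GroupRing.deltaHatMap_single, hm, zmultiplesHom_apply, one_smul]
  · rintro ⟨g, hg⟩
    -- The variable `t` is the group element `[1]` of `ℤ[ℤ]`.
    have h := GroupRing.map_unitOf_mem_rankOneUnits g (Multiplicative.ofAdd 1)
    rwa [show Units.map (g.toRingHom : _ →* AddMonoidAlgebra ℤ M)
      (GroupRing.unitOf ℤ (Multiplicative.ofAdd 1)) = u from Units.ext hg] at h
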